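/- Let $q=2$, $A=\mathbb{F}_2[t]$, $K=\mathbb{F}_2(t)$, and let $K_\infty=\mathbb{F}_2((1/t))$ be the completion of $K$ at the infinite place. For positive integers $s_1,\dots,s_r$ let $$\zeta(s_1,\dots,s_r)=\sum \frac{1}{a_1^{s_1}\cdots a_r^{s_r}}\in K_\infty ,$$ where the sum is over all monic polynomials $a_1,\dots,a_r\in A$ with $\deg a_1>\dots>\deg a_r\ge 0$ (in particular $\zeta(s)=\sum_{a\in A\text{ monic}}a^{-s}$). These series converge in $K_\infty$, and for every integer $b\ge 1$, $$\begin{aligned}\zeta(3)\zeta(b)={}&\zeta(b+3)+\zeta(3,b)+\zeta(b,3)\\&+\sum_{i=0}^{\lfloor (b-5)/4\rfloor}\zeta(b-1-4i,\,4+4i)+\sum_{i=0}^{\lfloor (b-4)/4\rfloor}\zeta(b-4i,\,3+4i)\\&+\sum_{i=1}^{2}\epsilon_i\,\bigl(\zeta(2,b+1)+\zeta(3,b)\bigr),\end{aligned}$$ where $\epsilon_i=1$ if $4\mid b-i$ and $\epsilon_i=0$ otherwise, and a sum whose upper limit is negative is $0$. -/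

import Mathlib

open Polynomial

noncomputable section

open Classical in
/-- `K_∞ = F((1/t))`, the completion of `K = F(t)` at the infinite place. -/
abbrev KInfty (F : Type*) [Field F] : Type _ :=
  RatFunc.CompletionAtInfty F

/-- The embedding of `A = F[t]` into `K_∞`, through `K = F(t)`. -/
def toKInfty (F : Type*) [Field F] : F[X] →+* KInfty F :=
  (algebraMap (RatFunc F) (KInfty F)).comp (algebraMap F[X] (RatFunc F))

/-- The index set of a multizeta series of depth `r`: tuples `(a₁, …, a_r)` of monic polynomials
with `deg a₁ > ⋯ > deg a_r` (`≥ 0`). -/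
abbrev MonicTuple (F : Type*) [Field F] (r : ℕ) : Type _ :=
  {a : Fin r → F[X] // (∀ i, (a i).Monic) ∧ StrictAnti fun i => (a i).natDegree}

/-- The general term `1 / (a₁ ^ s₁ ⋯ a_r ^ s_r)` of a multizeta series. -/
def multizetaTerm (F : Type*) [Field F] {r : ℕ} (s : Fin r → ℤ) (a : MonicTuple F r) :
    KInfty F :=
  1 / ∏ i, toKInfty F (a.1 i) ^ s i

/-- Thakur's multizeta value `ζ(s₁, …, s_r) = ∑ 1 / (a₁ ^ s₁ ⋯ a_r ^ s_r)` in `K_∞`, the sum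
being over monic `a_i` with `deg a₁ > ⋯ > deg a_r ≥ 0`. In depth one it is the Carlitz zeta value
`ζ(s) = ∑ 1 / a ^ s`, summed over all monic `a`. -/
def multizeta (F : Type*) [Field F] {r : ℕ} (s : Fin r → ℤ) : KInfty F :=
  ∑' a : MonicTuple F r, multizetaTerm F s a

end

open Polynomial Filter Topology

/-! Convergence is non-archimedean, so ζ(3)ζ(b) may be summed over all pairs of monic polynomials.
Equal pairs and pairs of unequal degree give ζ(b+3), ζ(3,b) and ζ(b,3). The other pairs are (x, x+m)
with m ≠ 0 and deg m < deg x; over two elements such an m is monic. Partial fractions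
(`one_div_cube_mul_zpow_eq_partialFractions`) split 1/(x³(x+m)^b) into terms 1/(x^i m^j) and
1/((x+m)^i m^j). Both kinds sum to ζ(i,j), because (x,m) ↦ (x+m,m) permutes the index set. In
characteristic two the copies of ζ(1,b+2) cancel and the rest collapses to the stated coefficients.
-/

/-! ### Convergence of multizeta series -/

instance KInfty.instNonarchimedeanRing (F : Type*) [Field F] : NonarchimedeanRing (KInfty F) where
  is_nonarchimedean U hU := by
    obtain ⟨γ, hγ⟩ := Valued.mem_nhds_zero.mp hU
    refine ⟨⟨(Valued.v (R := KInfty F)).restrict.ltAddSubgroup γ, ?_⟩, hγ⟩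
    exact AddSubgroup.isOpen_of_mem_nhds _ (g := 0) (Valued.mem_nhds_zero.mpr ⟨γ, subset_rfl⟩)

instance KInfty.instCompleteSpace (F : Type*) [Field F] : CompleteSpace (KInfty F) := by
  classical
  let := (RatFunc.inftyValued F).toUniformSpace
  exact inferInstanceAs (CompleteSpace (UniformSpace.Completion (RatFunc F)))

theorem valuation_toKInfty {F : Type*} [Field F] {p : F[X]} (hp : p ≠ 0) :
    Valued.v (toKInfty F p) = WithZero.exp (p.natDegree : ℤ) := by
  classical
  rw [← RatFunc.inftyValuation.polynomial F hp, RatFunc.valuedCompletionAtInfty.def]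
  let := RatFunc.inftyValued F
  exact Valued.extensionValuation_apply_coe (algebraMap F[X] (RatFunc F) p)

theorem Polynomial.finite_setOf_natDegree_le {F : Type*} [Field F] [Finite F] (n : ℕ) :
    {p : F[X] | p.natDegree ≤ n}.Finite := by
  have h : Finite (degreeLT F (n + 1)) :=
    Finite.of_equiv _ (degreeLTEquiv F (n + 1)).toEquiv.symm
  refine Set.Finite.subset (s := (degreeLT F (n + 1) : Set F[X])) h fun p hp => ?_
  exact mem_degreeLT.mpr (degree_lt_iff_coeff_zero _ _ |>.mpr fun k hk =>
    coeff_eq_zero_of_natDegree_lt (lt_of_le_of_lt hp hk))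

theorem WithZero.exp_sum_eq_prod {ι : Type*} (s : Finset ι) (f : ι → ℤ) :
    WithZero.exp (∑ i ∈ s, f i) = ∏ i ∈ s, WithZero.exp (f i) := by
  classical
  induction s using Finset.induction_on with
  | empty => simp
  | insert i s hi ih => rw [Finset.sum_insert hi, Finset.prod_insert hi, WithZero.exp_add, ih]

/-- Each factor of the denominator has valuation at least 1, so all but the i-th can be dropped. -/
theorem valuation_multizetaTerm_le {F : Type*} [Field F] {r : ℕ} {s : Fin r → ℤ}
    (hs : ∀ i, 1 ≤ s i) (a : MonicTuple F r) (i : Fin r) :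
    Valued.v (multizetaTerm F s a) ≤ WithZero.exp (-((a.1 i).natDegree : ℤ)) := by
  have h : Valued.v (multizetaTerm F s a) =
      WithZero.exp (-∑ j, s j * ((a.1 j).natDegree : ℤ)) := by
    rw [multizetaTerm, one_div, map_inv₀, map_prod, WithZero.exp_neg, WithZero.exp_sum_eq_prod]
    congr 1
    refine Finset.prod_congr rfl fun j _ => ?_
    rw [map_zpow₀, valuation_toKInfty (a.2.1 j).ne_zero, ← WithZero.exp_zsmul, smul_eq_mul]
  rw [h, WithZero.exp_le_exp, neg_le_neg_iff]
  calc ((a.1 i).natDegree : ℤ) ≤ s i * ((a.1 i).natDegree : ℤ) := by nlinarith [hs i]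
    _ ≤ _ := Finset.single_le_sum (f := fun j => s j * ((a.1 j).natDegree : ℤ))
      (fun j _ => mul_nonneg (by linarith [hs j]) (by positivity)) (Finset.mem_univ i)

/-- In a complete non-archimedean group it suffices that terms tend to 0 cofinitely; only finitely
many tuples have all degrees bounded. -/
theorem summable_multizetaTerm {F : Type*} [Field F] [Finite F] {r : ℕ} {s : Fin r → ℤ}
    (hs : ∀ i, 1 ≤ s i) : Summable (multizetaTerm F s) := by
  refine NonarchimedeanAddGroup.summable_of_tendsto_cofinite_zero ?_
  rw [(Valued.hasBasis_nhds_zero (KInfty F) _).tendsto_right_iff]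
  intro γ _
  have hγ := MonoidWithZeroHom.ValueGroup₀.embedding_strictMono
    (f := .ofClass (Valued.v (R := KInfty F))) (Units.zero_lt γ)
  rw [map_zero] at hγ
  obtain ⟨n, hn⟩ : ∃ n : ℤ, WithZero.exp n =
    MonoidWithZeroHom.ValueGroup₀.embedding (f := .ofClass (Valued.v (R := KInfty F))) γ.1 :=
    ⟨_, WithZero.exp_log hγ.ne'⟩
  have hfin : {a : MonicTuple F r | ∀ i, a.1 i ∈ {p : F[X] | p.natDegree ≤ (-n).toNat}}.Finite :=
    (Set.Finite.pi' fun _ => finite_setOf_natDegree_le _).preimage Subtype.val_injective.injOn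
  refine hfin.subset fun a ha i => ?_
  by_contra hi
  refine ha ?_
  simp only [Set.mem_ofPred_eq, not_le] at hi ⊢
  rw [Valuation.restrict_lt_iff_lt_embedding, ← hn]
  refine (valuation_multizetaTerm_le hs a i).trans_lt (WithZero.exp_lt_exp.mpr ?_)
  omega

/-! ### Partial fractions in characteristic two -/

theorem Int.sum_Icc_zero_add_one {M : Type*} [AddCommMonoid M] (f : ℤ → M) {n : ℤ}
    (hn : -1 ≤ n) :
    ∑ i ∈ Finset.Icc 0 (n + 1), f i = f 0 + ∑ i ∈ Finset.Icc 0 n, f (i + 1) := by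
  have h : Finset.Icc (0 : ℤ) (n + 1) = insert 0 ((Finset.Icc 0 n).map (addRightEmbedding 1)) := by
    ext i
    simp only [Finset.map_add_right_Icc, Finset.mem_insert, Finset.mem_Icc]
    omega
  rw [h, Finset.sum_insert (by simp), Finset.sum_map]
  rfl

/-- The partial fraction expansion of `1 / (x ^ 3 * y ^ b)` in characteristic two, where
`y = x + m`, in terms of products of powers of `m` with powers of `x` or of `y`. -/
theorem one_div_cube_mul_zpow_eq_partialFractions {L : Type*} [Field L] [CharP L 2] {x y m : L}
    (hx : x ≠ 0) (hy : y ≠ 0) (hm : m ≠ 0) (hxy : y = x + m) (n : ℕ) (b : ℤ) (hb : b = n + 1)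
    (e : ℤ → L) (he : ∀ i, e i = if (4 : ℤ) ∣ b - i then 1 else 0) :
    1 / (x ^ (3 : ℤ) * y ^ b) =
      ∑ i ∈ Finset.Icc (0 : ℤ) ((b - 5) / 4), 1 / (y ^ (b - 1 - 4 * i) * m ^ (4 + 4 * i))
      + ∑ i ∈ Finset.Icc (0 : ℤ) ((b - 4) / 4), 1 / (y ^ (b - 4 * i) * m ^ (3 + 4 * i))
      + (1 / (x ^ (3 : ℤ) * m ^ b)
        + (e 1 + e 3) * (1 / (x ^ (2 : ℤ) * m ^ (b + 1)))
        + (e 1 + e 2) * (1 / (x ^ (1 : ℤ) * m ^ (b + 2)))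
        + (e 1 + e 2) * (1 / (y ^ (1 : ℤ) * m ^ (b + 2)))
        + (e 2 + e 3) * (1 / (y ^ (2 : ℤ) * m ^ (b + 1)))
        + (e 3 + e 4) * (1 / (y ^ (3 : ℤ) * m ^ b))) := by
  have h2 : (2 : L) = 0 := CharTwo.two_eq_zero
  obtain rfl : x = y + m := by rw [hxy]; linear_combination (-m) * h2
  clear hxy
  induction n using Nat.strong_induction_on generalizing b with
  | _ n ih =>
  match n with
  | 0 =>
    obtain rfl : b = 1 := by simpa using hb
    norm_num [he]
    field_simp
    clear he; grind
  | 1 =>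
    obtain rfl : b = 2 := by simpa using hb
    norm_num [he]
    field_simp
    clear he; grind
  | 2 =>
    obtain rfl : b = 3 := by simpa using hb
    norm_num [he]
    field_simp
    clear he; grind
  | 3 =>
    obtain rfl : b = 4 := by simpa using hb
    norm_num [he]
    field_simp
    clear he; grind
  -- The coefficients `e i` depend only on b mod 4, hence induction in steps of 4.
  | k + 4 =>
    obtain ⟨c, rfl⟩ : ∃ c : ℤ, b = c + 4 := ⟨b - 4, by ring⟩
    have key := ih k (by omega) c (by push_cast at hb; omega) (fun i => by
      rw [he]; congr 1; simp only [eq_iff_iff]; omega)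
    rw [show (c + 4 - 5) / 4 = (c - 5) / 4 + 1 by omega,
      show (c + 4 - 4) / 4 = (c - 4) / 4 + 1 by omega,
      Int.sum_Icc_zero_add_one _ (by push_cast at hb; omega),
      Int.sum_Icc_zero_add_one _ (by push_cast at hb; omega)]
    have hs : ∀ u v : ℤ, 1 / (y ^ u * m ^ (v + 4)) = 1 / (y ^ u * m ^ v) * (1 / m ^ 4) := by
      intro u v
      rw [zpow_add₀ hm]
      norm_cast
      field_simp
    have hs' : ∀ u v : ℤ, 1 / ((y + m) ^ u * m ^ (v + 4)) =
        1 / ((y + m) ^ u * m ^ v) * (1 / m ^ 4) := by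
      intro u v
      rw [zpow_add₀ hm]
      norm_cast
      field_simp
    have s1 : ∑ i ∈ Finset.Icc (0 : ℤ) ((c - 5) / 4),
        1 / (y ^ (c + 4 - 1 - 4 * (i + 1)) * m ^ (4 + 4 * (i + 1))) =
        (∑ i ∈ Finset.Icc (0 : ℤ) ((c - 5) / 4),
          1 / (y ^ (c - 1 - 4 * i) * m ^ (4 + 4 * i))) * (1 / m ^ 4) := by
      rw [Finset.sum_mul]
      refine Finset.sum_congr rfl fun i _ => ?_
      rw [← hs]
      congr 3 <;> ring
    have s2 : ∑ i ∈ Finset.Icc (0 : ℤ) ((c - 4) / 4),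
        1 / (y ^ (c + 4 - 4 * (i + 1)) * m ^ (3 + 4 * (i + 1))) =
        (∑ i ∈ Finset.Icc (0 : ℤ) ((c - 4) / 4),
          1 / (y ^ (c - 4 * i) * m ^ (3 + 4 * i))) * (1 / m ^ 4) := by
      rw [Finset.sum_mul]
      refine Finset.sum_congr rfl fun i _ => ?_
      rw [← hs]
      congr 3 <;> ring
    -- From x⁴ = y⁴ + m⁴: 1/y⁴ - 1/m⁴ = x⁴/(y⁴m⁴), then x = y + m splits the remainder into the two
    -- i = 0 terms.
    have t : 1 / ((y + m) ^ (3 : ℤ) * y ^ (c + 4)) =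
        1 / ((y + m) ^ (3 : ℤ) * y ^ c) * (1 / m ^ 4) +
        1 / (y ^ (c + 4 - 1 - 4 * 0) * m ^ (4 + 4 * 0 : ℤ)) +
        1 / (y ^ (c + 4 - 4 * 0) * m ^ (3 + 4 * 0 : ℤ)) := by
      rw [show c + 4 - 1 - 4 * 0 = c + 3 by ring, show c + 4 - 4 * 0 = c + 4 by ring,
        zpow_add₀ hy, zpow_add₀ hy]
      norm_num
      have := zpow_ne_zero c hy
      field_simp
      clear he; grind
    rw [t, s1, s2, key, show c + 4 + 1 = c + 1 + 4 by ring, show c + 4 + 2 = c + 2 + 4 by ring]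
    simp only [hs, hs']
    ring

/-! ### Pairs of monic polynomials over the field with two elements -/

theorem Field.eq_one_of_natCard_eq_two {F : Type*} [Field F] (hq : Nat.card F = 2) {x : F}
    (hx : x ≠ 0) : x = 1 :=
  ((Nat.card_eq_two_iff' (0 : F)).mp hq).unique hx one_ne_zero

theorem Field.charTwo_of_natCard_eq_two {F : Type*} [Field F] (hq : Nat.card F = 2) :
    CharP F 2 := by
  refine CharTwo.of_one_ne_zero_of_two_eq_zero one_ne_zero ?_
  by_contra h
  have := eq_one_of_natCard_eq_two hq h
  exact one_ne_zero (α := F) (by linear_combination this)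

theorem toKInfty_injective (F : Type*) [Field F] : Function.Injective (toKInfty F) :=
  (algebraMap (RatFunc F) (KInfty F)).injective.comp (IsFractionRing.injective F[X] (RatFunc F))

theorem KInfty.charP (F : Type*) [Field F] (p : ℕ) [CharP F p] : CharP (KInfty F) p :=
  charP_of_injective_ringHom (toKInfty_injective F) p

namespace MonicTuple

variable {F : Type*} [Field F]

/-- The one-term tuple `(p)`. -/
def single (p : F[X]) (hp : p.Monic) : MonicTuple F 1 :=
  ⟨![p], by simpa using hp, Subsingleton.strictAnti _⟩

/-- The tuple `(p, q)`. -/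
def pair (p q : F[X]) (hp : p.Monic) (hq : q.Monic) (h : q.natDegree < p.natDegree) :
    MonicTuple F 2 :=
  ⟨![p, q], by simp [Fin.forall_fin_two, hp, hq], by
    intro i j hij
    obtain ⟨rfl, rfl⟩ : i = 0 ∧ j = 1 := by omega
    simpa using h⟩

theorem natDegree_lt (a : MonicTuple F 2) : (a.1 1).natDegree < (a.1 0).natDegree :=
  a.2.2 Fin.zero_lt_one

theorem single_ext {a b : MonicTuple F 1} (h : a.1 0 = b.1 0) : a = b :=
  Subtype.ext (funext fun i => by rwa [Subsingleton.elim i 0])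

theorem pair_ext {a b : MonicTuple F 2} (h₀ : a.1 0 = b.1 0) (h₁ : a.1 1 = b.1 1) : a = b :=
  Subtype.ext (funext fun i => by fin_cases i <;> assumption)

theorem monic_add (a : MonicTuple F 2) : (a.1 0 + a.1 1).Monic :=
  (a.2.1 0).add_of_left (degree_lt_degree a.natDegree_lt)

theorem natDegree_add (a : MonicTuple F 2) : (a.1 0 + a.1 1).natDegree = (a.1 0).natDegree :=
  natDegree_add_eq_left_of_natDegree_lt a.natDegree_lt

/-- In characteristic two, `(a, m) ↦ (a + m, m)` is an involution. -/
noncomputable def addEquiv [CharP F 2] : Equiv.Perm (MonicTuple F 2) :=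
  Function.Involutive.toPerm
    (fun a => pair (a.1 0 + a.1 1) (a.1 1) a.monic_add (a.2.1 1)
      (a.natDegree_add.symm ▸ a.natDegree_lt))
    fun a => pair_ext (by simp [pair, add_assoc, CharTwo.add_self_eq_zero]) (by simp [pair])

/-- A pair of monic polynomials is `(a, a)`, `(a, c)` or `(c, a)` with `deg c < deg a`, or
`(a, a + m)` with `m` nonzero and `deg m < deg a`; over the field with two elements this `m` is
monic. -/
noncomputable def toProd : MonicTuple F 1 ⊕ (MonicTuple F 2 ⊕ (MonicTuple F 2 ⊕ MonicTuple F 2)) →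
    MonicTuple F 1 × MonicTuple F 1
  | .inl a => (a, a)
  | .inr (.inl a) => (single (a.1 0) (a.2.1 0), single (a.1 1) (a.2.1 1))
  | .inr (.inr (.inl a)) => (single (a.1 1) (a.2.1 1), single (a.1 0) (a.2.1 0))
  | .inr (.inr (.inr a)) => (single (a.1 0) (a.2.1 0), single (a.1 0 + a.1 1) a.monic_add)

/-- Comparing degrees separates the cases, and in the last one m is the difference of the two
entries. -/
theorem toProd_bijective (hq : Nat.card F = 2) : Function.Bijective (toProd (F := F)) := by
  have := Field.charTwo_of_natCard_eq_two hq
  constructor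
  · intro a b h
    have h₁ : (toProd a).1.1 0 = (toProd b).1.1 0 := by rw [h]
    have h₂ : (toProd a).2.1 0 = (toProd b).2.1 0 := by rw [h]
    rcases a with a | a | a | a <;> rcases b with b | b | b | b <;>
      simp only [toProd, single, Matrix.cons_val_zero] at h₁ h₂
    · rw [single_ext h₁]
    all_goals
      try have hb := b.natDegree_lt
      try have hb' := b.natDegree_add
      try have hb'' := (b.2.1 1).ne_zero
      try have ha := a.natDegree_lt
      try have ha' := a.natDegree_add
      try have ha'' := (a.2.1 1).ne_zero
    all_goals first
      | rw [pair_ext h₁ h₂]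
      | rw [pair_ext h₂ h₁]
      | rw [pair_ext h₁ (add_left_cancel (h₁ ▸ h₂))]
      | grind
  · rintro ⟨a, c⟩
    rcases lt_trichotomy (a.1 0).natDegree (c.1 0).natDegree with h | h | h
    · exact ⟨.inr (.inr (.inl (pair (c.1 0) (a.1 0) (c.2.1 0) (a.2.1 0) h))),
        Prod.ext (single_ext rfl) (single_ext rfl)⟩
    · by_cases hac : a = c
      · exact ⟨.inl a, by rw [toProd, hac]⟩
      · have hne : c.1 0 - a.1 0 ≠ 0 := fun h0 => hac (single_ext (sub_eq_zero.mp h0).symm)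
        have hdeg : (c.1 0 - a.1 0).natDegree < (a.1 0).natDegree := by
          rw [h]
          refine natDegree_lt_natDegree hne ?_
          refine degree_sub_lt_left ?_ (c.2.1 0).ne_zero ?_
          · rw [degree_eq_natDegree (c.2.1 0).ne_zero, degree_eq_natDegree (a.2.1 0).ne_zero, h]
          · rw [(c.2.1 0).leadingCoeff, (a.2.1 0).leadingCoeff]
        exact ⟨.inr (.inr (.inr (pair (a.1 0) (c.1 0 - a.1 0) (a.2.1 0)
          (Field.eq_one_of_natCard_eq_two hq (leadingCoeff_ne_zero.mpr hne)) hdeg))),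
          Prod.ext (single_ext rfl) (single_ext (add_sub_cancel _ _))⟩
    · exact ⟨.inr (.inl (pair (a.1 0) (c.1 0) (a.2.1 0) (c.2.1 0) h)),
        Prod.ext (single_ext rfl) (single_ext rfl)⟩

end MonicTuple

/-! ### Products of zeta values -/

theorem multizetaTerm_one {F : Type*} [Field F] (i : ℤ) (a : MonicTuple F 1) :
    multizetaTerm F ![i] a = 1 / toKInfty F (a.1 0) ^ i := by
  simp [multizetaTerm]

theorem multizetaTerm_two {F : Type*} [Field F] (i j : ℤ) (a : MonicTuple F 2) :
    multizetaTerm F ![i, j] a = 1 / (toKInfty F (a.1 0) ^ i * toKInfty F (a.1 1) ^ j) := by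
  simp [multizetaTerm]

theorem hasSum_multizeta_one {F : Type*} [Field F] [Finite F] {i : ℤ} (hi : 1 ≤ i) :
    HasSum (multizetaTerm F ![i]) (multizeta F ![i]) :=
  (summable_multizetaTerm (by simpa using hi)).hasSum

theorem hasSum_multizeta_two {F : Type*} [Field F] [Finite F] {i j : ℤ} (hi : 1 ≤ i)
    (hj : 1 ≤ j) : HasSum (multizetaTerm F ![i, j]) (multizeta F ![i, j]) :=
  (summable_multizetaTerm (by simp [Fin.forall_fin_two, hi, hj])).hasSum

theorem hasSum_multizeta_two_add {F : Type*} [Field F] [Finite F] [CharP F 2] {i j : ℤ}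
    (hi : 1 ≤ i) (hj : 1 ≤ j) :
    HasSum (fun a : MonicTuple F 2 =>
      1 / (toKInfty F (a.1 0 + a.1 1) ^ i * toKInfty F (a.1 1) ^ j)) (multizeta F ![i, j]) := by
  convert! (MonicTuple.addEquiv.hasSum_iff).mpr (hasSum_multizeta_two (F := F) hi hj) using 1
  ext a
  simp [multizetaTerm_two, MonicTuple.addEquiv, MonicTuple.pair]

/-- The product of two zeta values over the field with two elements: the pairs of distinct
polynomials of the same degree contribute the last summand. -/
theorem multizeta_one_mul_multizeta_one {F : Type*} [Field F] [Finite F]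
    (hq : Nat.card F = 2) {k b : ℤ} (hk : 1 ≤ k) (hb : 1 ≤ b) {z : KInfty F}
    (hz : HasSum (fun a : MonicTuple F 2 =>
      1 / (toKInfty F (a.1 0) ^ k * toKInfty F (a.1 0 + a.1 1) ^ b)) z) :
    multizeta F ![k] * multizeta F ![b] =
      multizeta F ![b + k] + (multizeta F ![k, b] + (multizeta F ![b, k] + z)) := by
  have h := (hasSum_multizeta_one (F := F) hk).mul_of_nonarchimedean (hasSum_multizeta_one hb)
  refine ((Equiv.ofBijective _ (MonicTuple.toProd_bijective hq)).hasSum_iff.mpr h).unique ?_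
  refine HasSum.sum ?_ (HasSum.sum ?_ (HasSum.sum ?_ ?_))
  · convert! hasSum_multizeta_one (F := F) (i := b + k) (by omega) using 1
    ext a
    have ha : toKInfty F (a.1 0) ≠ 0 :=
      (map_ne_zero_iff _ (toKInfty_injective F)).mpr (a.2.1 0).ne_zero
    simp [multizetaTerm_one, MonicTuple.toProd, zpow_add₀ ha]
  · convert! hasSum_multizeta_two (F := F) hk hb using 1
    ext a
    simp [multizetaTerm_one, multizetaTerm_two, MonicTuple.toProd, MonicTuple.single, mul_comm]
  · convert! hasSum_multizeta_two (F := F) hb hk using 1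
    ext a
    simp [multizetaTerm_one, multizetaTerm_two, MonicTuple.toProd, MonicTuple.single, mul_comm]
  · convert! hz using 1
    ext a
    simp [multizetaTerm_one, MonicTuple.toProd, MonicTuple.single, mul_comm]

/-- The contribution to `ζ(3) ζ(b)` of the pairs of distinct polynomials of the same degree. -/
theorem hasSum_one_div_cube_mul_add_zpow {F : Type*} [Field F] [Finite F] [CharP F 2] {b : ℤ}
    (hb : 1 ≤ b) (e : ℤ → KInfty F) (he : ∀ i, e i = if (4 : ℤ) ∣ b - i then 1 else 0) :
    HasSum (fun a : MonicTuple F 2 =>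
      1 / (toKInfty F (a.1 0) ^ (3 : ℤ) * toKInfty F (a.1 0 + a.1 1) ^ b))
      (∑ i ∈ Finset.Icc (0 : ℤ) ((b - 5) / 4), multizeta F ![b - 1 - 4 * i, 4 + 4 * i]
        + ∑ i ∈ Finset.Icc (0 : ℤ) ((b - 4) / 4), multizeta F ![b - 4 * i, 3 + 4 * i]
        + (multizeta F ![3, b] + (e 1 + e 3) * multizeta F ![2, b + 1]
          + (e 1 + e 2) * multizeta F ![1, b + 2] + (e 1 + e 2) * multizeta F ![1, b + 2]
          + (e 2 + e 3) * multizeta F ![2, b + 1] + (e 3 + e 4) * multizeta F ![3, b])) := by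
  have := KInfty.charP F 2
  have hz (p : F[X]) (hp : p.Monic) : toKInfty F p ≠ 0 :=
    (map_ne_zero_iff _ (toKInfty_injective F)).mpr hp.ne_zero
  have hx {i j : ℤ} (hi : 1 ≤ i) (hj : 1 ≤ j) : HasSum (fun a : MonicTuple F 2 =>
      1 / (toKInfty F (a.1 0) ^ i * toKInfty F (a.1 1) ^ j)) (multizeta F ![i, j]) := by
    simpa only [← multizetaTerm_two] using hasSum_multizeta_two hi hj
  have hy {i j : ℤ} (hi : 1 ≤ i) (hj : 1 ≤ j) :=
    hasSum_multizeta_two_add (F := F) hi hj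
  convert! ((hasSum_sum fun i hi => hy (i := b - 1 - 4 * i) (j := 4 + 4 * i) ?_ ?_).add
    (hasSum_sum fun i hi => hy (i := b - 4 * i) (j := 3 + 4 * i) ?_ ?_)).add
    ((((((hx (i := 3) (by norm_num) hb).add
      ((hx (i := 2) (j := b + 1) (by norm_num) (by omega)).mul_left (e 1 + e 3))).add
      ((hx (i := 1) (j := b + 2) (by norm_num) (by omega)).mul_left (e 1 + e 2))).add
      ((hy (i := 1) (j := b + 2) (by norm_num) (by omega)).mul_left (e 1 + e 2))).add
      ((hy (i := 2) (j := b + 1) (by norm_num) (by omega)).mul_left (e 2 + e 3))).add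
      ((hy (i := 3) (j := b) (by norm_num) hb).mul_left (e 3 + e 4))) using 1
  · ext a
    exact one_div_cube_mul_zpow_eq_partialFractions (hz _ (a.2.1 0)) (hz _ a.monic_add)
      (hz _ (a.2.1 1)) (map_add _ _ _) (b - 1).toNat b (by omega) e he
  -- The upper limits keep the exponents of y at least 4.
  all_goals rw [Finset.mem_Icc] at hi; omega

theorem theorem7p9 (F : Type*) [Field F] (hq : Nat.card F = 2) :
    (∀ (r : ℕ) (s : Fin r → ℤ), (∀ i, 1 ≤ s i) → Summable (multizetaTerm F s)) ∧
    ∀ b : ℤ, 1 ≤ b →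
      multizeta F ![3] * multizeta F ![b] =
        multizeta F ![b + 3] + multizeta F ![3, b] + multizeta F ![b, 3]
        + ∑ i ∈ Finset.Icc (0 : ℤ) ((b - 5) / 4), multizeta F ![b - 1 - 4 * i, 4 + 4 * i]
        + ∑ i ∈ Finset.Icc (0 : ℤ) ((b - 4) / 4), multizeta F ![b - 4 * i, 3 + 4 * i]
        + ∑ i ∈ Finset.Icc (1 : ℤ) 2, (if (4 : ℤ) ∣ b - i then 1 else 0) *
            (multizeta F ![2, b + 1] + multizeta F ![3, b]) := by
  have : Finite F := Nat.finite_of_card_ne_zero (by omega)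
  have := Field.charTwo_of_natCard_eq_two hq
  have := KInfty.charP F 2
  refine ⟨fun r s hs => summable_multizetaTerm hs, fun b hb => ?_⟩
  obtain ⟨e, he⟩ : ∃ e : ℤ → KInfty F, ∀ i, e i = if (4 : ℤ) ∣ b - i then 1 else 0 :=
    ⟨_, fun _ => rfl⟩
  have hsum : e 1 + e 2 + e 3 + e 4 = 1 := by
    obtain h | h | h | h : b % 4 = 1 ∨ b % 4 = 2 ∨ b % 4 = 3 ∨ b % 4 = 0 := by omega
    all_goals simp [he, Int.dvd_iff_emod_eq_zero, Int.sub_emod, h]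
  have h2 : (2 : KInfty F) = 0 := CharTwo.two_eq_zero
  rw [multizeta_one_mul_multizeta_one hq (by norm_num) hb
    (hasSum_one_div_cube_mul_add_zpow hb e he), show Finset.Icc (1 : ℤ) 2 = {1, 2} from rfl,
    Finset.sum_pair (by norm_num), ← he, ← he]
  -- Modulo 2, ζ(2,b+1) has coefficient e₁ + e₂ + 2e₃ = e₁ + e₂, and ζ(3,b) has 1 + e₃ + e₄ = 2 - e₁
  -- - e₂ = e₁ + e₂.
  linear_combination multizeta F ![3, b] * hsum + ((e 1 + e 2) * multizeta F ![1, b + 2]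
    + e 3 * multizeta F ![2, b + 1] + (1 - e 1 - e 2) * multizeta F ![3, b]) * h2
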